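/- Let $d\in\mathbb N$ and $\mathbb T^d=\mathbb R^d/\mathbb Z^d$, whose points are represented by the vectors of $[-\frac12,\frac12)^d$; a subset of $(-\frac12,\frac12)^d$ is also regarded as a subset of $\mathbb T^d$. For an open set $\Theta\subseteq\mathbb T^d$ let $\mathcal F^*(\Theta)$ be the set of all continuous functions $f:\mathbb T^d\to\mathbb R$ whose (closed) support is contained in $\Theta$, with $f(0)=1$, and which are positive definite, i.e. $\widehat f(n)=\int_{\mathbb T^d} f(x)e^{-2\pi i\langle n,x\rangle}\,dx\ge 0$ for all $n\in\mathbb Z^d$. For $w\in\mathbb T^d$ put $$\mathcal M^*(\Theta,w):=\sup_{f\in\mathcal F^*(\Theta)} f(w),$$ the supremum being taken in $[-\infty,\infty]$ (so that it equals $-\infty$ if $\mathcal F^*(\Theta)=\emptyset$). Let $\Omega\subseteq(-\frac12,\frac12)^d$ be open, $z\in[-\frac12,\frac12)^d$ and let $N\ge 1$ be an integer. Then $$\mathcal M^*\left(\tfrac1N\Omega,\tfrac1N z\right)\le \mathcal M^*(\Omega,z),$$ where $\frac1N\Omega=\{\frac1N x: x\in\Omega\}$ and the dilations are those of $\mathbb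 R^d$. -/

import Mathlib

open scoped Pointwise

noncomputable section

namespace TuranTorus

/-- The quotient map `ℝ^d → 𝕋^d = ℝ^d / ℤ^d`. -/
def toTorus {d : ℕ} (x : Fin d → ℝ) : UnitAddTorus (Fin d) :=
  fun i => ((x i : ℝ) : UnitAddCircle)

/-- A real function on `𝕋^d` is positive definite when all its Fourier coefficients
`∫_{𝕋^d} f(x) e^{-2πi⟨n,x⟩} dx`, `n ∈ ℤ^d`, are nonnegative real numbers. -/
def IsPosDef {d : ℕ} (f : UnitAddTorus (Fin d) → ℝ) : Prop :=
  ∀ n : Fin d → ℤ,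
    0 ≤ (UnitAddTorus.mFourierCoeff (fun x => (f x : ℂ)) n).re ∧
      (UnitAddTorus.mFourierCoeff (fun x => (f x : ℂ)) n).im = 0

/-- The class `𝓕*(Ω)`: continuous positive definite `f : 𝕋^d → ℝ` with (closed) support
contained in `Ω` and `f(0) = 1`. -/
def FStar {d : ℕ} (Ω : Set (UnitAddTorus (Fin d))) : Set (UnitAddTorus (Fin d) → ℝ) :=
  {f | Continuous f ∧ tsupport f ⊆ Ω ∧ f 0 = 1 ∧ IsPosDef f}

/-- The extremal quantity `𝓜*(Ω, z) = sup {f(z) : f ∈ 𝓕*(Ω)}`, a supremum in the extended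
reals (so it is `⊥` exactly when the class is empty, and is otherwise the usual supremum). -/
def MStar {d : ℕ} (Ω : Set (UnitAddTorus (Fin d))) (z : UnitAddTorus (Fin d)) : EReal :=
  ⨆ f ∈ FStar Ω, ((f z : ℝ) : EReal)

end TuranTorus

end

open MeasureTheory UnitAddTorus

namespace TuranTorus

variable {d : ℕ}

/-! Push an admissible `f` for `Ω/N` forward along the `N`-fold covering `y ↦ N • y`, letting `g(N •
y)` be the sum of `f(y + t)` over the `N`-torsion points `t`. Up to a nonnegative factor, the `n`-th
coefficient of `g` is the `Nn`-th of `f` (`mFourierCoeff_fibreSum`), so positive definiteness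
survives, and the support is carried into `Ω`. As `Ω` lies in the open unit box, the sum over the
fibre of `z` has at most one nonzero term, so `g(z) = f(z/N)` (`fibreSum_toTorus`); `z = 0` gives
the normalization. Thus every value competing on the left also competes on the right. -/

/-- The product of the normalized Haar measures on the factors of the torus. -/
noncomputable abbrev torusHaar (d : ℕ) : Measure (UnitAddTorus (Fin d)) :=
  Measure.pi fun _ => AddCircle.haarAddCircle

theorem mFourierCoeff_eq_integral_torusHaar (f : UnitAddTorus (Fin d) → ℂ) (n : Fin d → ℤ) :
    mFourierCoeff f n = ∫ t, mFourier (-n) t • f t ∂(torusHaar d) := rfl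

theorem nsmul_surjective {N : ℕ} (hN : 1 ≤ N) :
    Function.Surjective fun y : UnitAddTorus (Fin d) => N • y := by
  intro x
  refine ⟨fun i => DivisibleBy.div (x i) (N : ℤ), ?_⟩
  funext i
  have := DivisibleBy.div_cancel (x i) (n := (N : ℤ)) (by omega)
  simpa using this

/-- A continuous surjective endomorphism of a compact group pushes Haar measure to a Haar measure,
here of the same total mass. -/
theorem measurePreserving_nsmul {N : ℕ} (hN : 1 ≤ N) :
    MeasurePreserving (fun y : UnitAddTorus (Fin d) => N • y) (torusHaar d) (torusHaar d) :=
  (nsmulAddMonoidHom (α := UnitAddTorus (Fin d)) N).measurePreserving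
    (continuous_nsmul N) (nsmul_surjective hN) rfl

theorem isQuotientMap_nsmul {N : ℕ} (hN : 1 ≤ N) :
    Topology.IsQuotientMap fun y : UnitAddTorus (Fin d) => N • y :=
  (continuous_nsmul N).isClosedMap.isQuotientMap (continuous_nsmul N) (nsmul_surjective hN)

theorem finite_torsion {N : ℕ} (hN : 1 ≤ N) :
    {t : UnitAddTorus (Fin d) | N • t = 0}.Finite := by
  refine (Set.Finite.pi' fun _ : Fin d => AddCircle.finite_torsion (1 : ℝ) hN).subset ?_
  intro t ht i
  exact congrFun ht i

theorem mFourier_add_right (n : Fin d → ℤ) (x y : UnitAddTorus (Fin d)) :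
    mFourier n (x + y) = mFourier n x * mFourier n y := by
  simp [mFourier, fourier_apply, smul_add, AddCircle.toCircle_add, Finset.prod_mul_distrib]

theorem mFourier_nsmul_right (n : Fin d → ℤ) (N : ℕ) (x : UnitAddTorus (Fin d)) :
    mFourier n (N • x) = mFourier (N • n) x := by
  simp only [mFourier, fourier_apply, ContinuousMap.coe_mk, Pi.smul_apply]
  refine Finset.prod_congr rfl fun i _ => ?_
  rw [← natCast_zsmul (x i), smul_smul, nsmul_eq_mul, mul_comm]

theorem mFourierCoeff_comp_nsmul {N : ℕ} (hN : 1 ≤ N) {g : UnitAddTorus (Fin d) → ℂ}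
    (hg : Continuous g) (n : Fin d → ℤ) :
    mFourierCoeff (fun y => g (N • y)) (N • n) = mFourierCoeff g n := by
  simp only [mFourierCoeff_eq_integral_torusHaar]
  have hc : Continuous fun t => mFourier (-n) t • g t := by fun_prop
  conv_rhs => rw [← (measurePreserving_nsmul (d := d) hN).map_eq]
  rw [integral_map (measurePreserving_nsmul hN).aemeasurable hc.aestronglyMeasurable]
  simp only [mFourier_nsmul_right, smul_neg]

theorem mFourierCoeff_comp_add_right (f : UnitAddTorus (Fin d) → ℂ) (n : Fin d → ℤ)
    (t : UnitAddTorus (Fin d)) :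
    mFourierCoeff (fun y => f (y + t)) n = mFourier n t * mFourierCoeff f n := by
  simp only [mFourierCoeff_eq_integral_torusHaar]
  rw [← integral_add_right_eq_self (fun y => mFourier (-n) y • f y) t, ← integral_const_mul]
  refine integral_congr_ae (.of_forall fun y => ?_)
  have h : mFourier n t * mFourier (-n) t = 1 := by
    rw [← mFourier_add, add_neg_cancel, mFourier_zero, ContinuousMap.one_apply]
  simp only [mFourier_add_right, smul_eq_mul]
  linear_combination (-(mFourier (-n) y * f (y + t))) * h

/-- The push-forward of a function along multiplication by `N`: the sum of its values over the
fibre, written as a sum over the `N`-torsion translates of one point of that fibre. -/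
theorem exists_fibreSum {N : ℕ} (hN : 1 ≤ N) (f : UnitAddTorus (Fin d) → ℝ) :
    ∃ g : UnitAddTorus (Fin d) → ℝ,
      ∀ y, g (N • y) = ∑ t ∈ (finite_torsion (d := d) hN).toFinset, f (y + t) := by
  refine ⟨fun x => ∑ t ∈ (finite_torsion (d := d) hN).toFinset,
    f (Function.surjInv (nsmul_surjective hN) x + t), fun y => ?_⟩
  set y' := Function.surjInv (nsmul_surjective hN) (N • y) with hy'
  have h : N • y' = N • y := Function.surjInv_eq (nsmul_surjective hN) (N • y)
  -- Two preimages of one point differ by a torsion element, so changing the base point only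
  -- permutes the summands.
  refine Finset.sum_equiv (Equiv.addRight (y' - y)) (fun t => ?_) fun t _ => ?_
  · simp [smul_add, smul_sub, h]
  · congr 1
    simp only [Equiv.coe_addRight]
    abel

section FibreSum

variable {N : ℕ} (hN : 1 ≤ N) {f g : UnitAddTorus (Fin d) → ℝ}
  (hg : ∀ y, g (N • y) = ∑ t ∈ (finite_torsion (d := d) hN).toFinset, f (y + t))

include hg

theorem continuous_fibreSum (hf : Continuous f) : Continuous g := by
  rw [(isQuotientMap_nsmul hN).continuous_iff]
  have : (g ∘ fun y => N • y) =
      fun y => ∑ t ∈ (finite_torsion (d := d) hN).toFinset, f (y + t) := funext hg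
  rw [this]
  fun_prop

theorem tsupport_fibreSum_subset : tsupport g ⊆ (fun y => N • y) '' tsupport f := by
  refine closure_minimal (fun x hx => ?_)
    ((continuous_nsmul N).isClosedMap _ (isClosed_tsupport f))
  obtain ⟨y, rfl⟩ := nsmul_surjective hN x
  have hx : g (N • y) ≠ 0 := hx
  rw [hg] at hx
  obtain ⟨t, ht, hft⟩ := Finset.exists_ne_zero_of_sum_ne_zero hx
  have ht : N • t = 0 := by simpa using ht
  exact ⟨y + t, subset_tsupport f hft, by simp [smul_add, ht]⟩

/-- The character of frequency `N • n` is trivial on `N`-torsion, so all the translates of `f` have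
the same coefficient there. -/
theorem mFourierCoeff_fibreSum (hf : Continuous f) (n : Fin d → ℤ) :
    mFourierCoeff (fun x => (g x : ℂ)) n =
      (finite_torsion (d := d) hN).toFinset.card *
        mFourierCoeff (fun x => (f x : ℂ)) (N • n) := by
  have hgc := continuous_fibreSum hN hg hf
  rw [← mFourierCoeff_comp_nsmul hN (by fun_prop : Continuous fun x => (g x : ℂ))]
  simp only [hg, Complex.ofReal_sum]
  have hsum : mFourierCoeff (fun y => ∑ t ∈ (finite_torsion (d := d) hN).toFinset,
        (f (y + t) : ℂ)) (N • n) =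
      ∑ t ∈ (finite_torsion (d := d) hN).toFinset,
        mFourierCoeff (fun y => (f (y + t) : ℂ)) (N • n) := by
    simp only [mFourierCoeff_eq_integral_torusHaar, Finset.smul_sum]
    refine integral_finsetSum _ fun t _ => ?_
    exact Continuous.integrable_of_hasCompactSupport (by fun_prop) (.of_compactSpace _)
  rw [hsum, ← nsmul_eq_mul]
  refine Finset.sum_eq_card_nsmul fun t ht => ?_
  have ht : N • t = 0 := by simpa using ht
  rw [mFourierCoeff_comp_add_right (fun y => (f y : ℂ)), ← mFourier_nsmul_right, ht]
  simp [mFourier]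

theorem isPosDef_fibreSum (hf : Continuous f) (hpos : IsPosDef f) : IsPosDef g := by
  intro n
  rw [mFourierCoeff_fibreSum hN hg hf]
  obtain ⟨h1, h2⟩ := hpos (N • n)
  rw [← Complex.ofReal_natCast]
  constructor
  · rw [Complex.re_ofReal_mul]
    positivity
  · rw [Complex.im_ofReal_mul, h2, mul_zero]

end FibreSum

theorem nsmul_toTorus (N : ℕ) (x : Fin d → ℝ) : N • toTorus x = toTorus (N • x) := rfl

theorem nsmul_inv_smul {N : ℕ} (hN : 1 ≤ N) (x : Fin d → ℝ) : N • ((N : ℝ)⁻¹ • x) = x := by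
  rw [← Nat.cast_smul_eq_nsmul ℝ, smul_inv_smul₀ (by positivity)]

theorem eq_of_toTorus_eq {x z : Fin d → ℝ} (hx : ∀ i, x i ∈ Set.Ioo (-(1 / 2) : ℝ) (1 / 2))
    (hz : ∀ i, z i ∈ Set.Ico (-(1 / 2) : ℝ) (1 / 2)) (h : toTorus x = toTorus z) : x = z := by
  funext i
  have hi : ((x i : ℝ) : UnitAddCircle) = ((z i : ℝ) : UnitAddCircle) := congrFun h i
  have mem (u : ℝ) (hu : u ∈ Set.Ico (-(1 / 2) : ℝ) (1 / 2)) :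
      u ∈ Set.Ico (-(1 / 2) : ℝ) (-(1 / 2) + 1) := ⟨hu.1, by linarith [hu.2]⟩
  exact (AddCircle.coe_eq_coe_iff_of_mem_Ico (mem _ ⟨(hx i).1.le, (hx i).2⟩)
    (mem _ (hz i))).1 hi

theorem fibreSum_toTorus {Ω : Set (Fin d → ℝ)}
    (hbox : ∀ x ∈ Ω, ∀ i, x i ∈ Set.Ioo (-(1 / 2) : ℝ) (1 / 2)) {N : ℕ} (hN : 1 ≤ N)
    {f g : UnitAddTorus (Fin d) → ℝ}
    (hg : ∀ y, g (N • y) = ∑ t ∈ (finite_torsion (d := d) hN).toFinset, f (y + t))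
    (hf : tsupport f ⊆ toTorus '' ((N : ℝ)⁻¹ • Ω))
    {z : Fin d → ℝ} (hz : ∀ i, z i ∈ Set.Ico (-(1 / 2) : ℝ) (1 / 2)) :
    g (toTorus z) = f (toTorus ((N : ℝ)⁻¹ • z)) := by
  have h := hg (toTorus ((N : ℝ)⁻¹ • z))
  rw [nsmul_toTorus, nsmul_inv_smul hN] at h
  rw [h, Finset.sum_eq_single 0, add_zero]
  · intro t ht ht0
    have ht : N • t = 0 := by simpa using ht
    by_contra hne
    obtain ⟨_, ⟨x, hx, rfl⟩, hxt⟩ := hf (subset_tsupport f hne)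
    -- Multiplying by `N` kills `t` and leaves `x ≡ z` modulo `ℤ^d`; both lie in one fundamental
    -- domain, so `x = z`, which forces `t = 0`.
    have hN' := congrArg (N • ·) hxt
    simp only [smul_add, nsmul_toTorus, nsmul_inv_smul hN, ht, add_zero] at hN'
    rw [eq_of_toTorus_eq (hbox x hx) hz hN'] at hxt
    exact ht0 (by simpa using hxt)
  · simp

theorem exists_mem_FStar_of_dilation {Ω : Set (Fin d → ℝ)}
    (hbox : ∀ x ∈ Ω, ∀ i, x i ∈ Set.Ioo (-(1 / 2) : ℝ) (1 / 2)) {N : ℕ} (hN : 1 ≤ N)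
    {f : UnitAddTorus (Fin d) → ℝ} (hf : f ∈ FStar (toTorus '' ((N : ℝ)⁻¹ • Ω))) :
    ∃ g ∈ FStar (toTorus '' Ω), ∀ z : Fin d → ℝ,
      (∀ i, z i ∈ Set.Ico (-(1 / 2) : ℝ) (1 / 2)) →
        g (toTorus z) = f (toTorus ((N : ℝ)⁻¹ • z)) := by
  obtain ⟨hcont, hsupp, h0, hpos⟩ := hf
  obtain ⟨g, hg⟩ := exists_fibreSum hN f
  have hval : ∀ z : Fin d → ℝ, (∀ i, z i ∈ Set.Ico (-(1 / 2) : ℝ) (1 / 2)) →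
      g (toTorus z) = f (toTorus ((N : ℝ)⁻¹ • z)) :=
    fun z hz => fibreSum_toTorus hbox hN hg hsupp hz
  refine ⟨g, ⟨continuous_fibreSum hN hg hcont, ?_, ?_, isPosDef_fibreSum hN hg hcont hpos⟩, hval⟩
  · refine (tsupport_fibreSum_subset hN hg).trans ?_
    rintro _ ⟨_, hy, rfl⟩
    obtain ⟨_, ⟨x, hx, rfl⟩, rfl⟩ := hsupp hy
    exact ⟨x, hx, by simp only [nsmul_toTorus, nsmul_inv_smul hN]⟩
  · have h := hval 0 fun i => by norm_num
    rw [smul_zero] at h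
    exact h.trans h0

end TuranTorus

theorem mainTheorem11 (d : ℕ) (Ω : Set (Fin d → ℝ)) (hΩ : IsOpen Ω)
    (hbox : ∀ x ∈ Ω, ∀ i, x i ∈ Set.Ioo (-(1 / 2) : ℝ) (1 / 2))
    (z : Fin d → ℝ) (hz : ∀ i, z i ∈ Set.Ico (-(1 / 2) : ℝ) (1 / 2))
    (N : ℕ) (hN : 1 ≤ N) :
    TuranTorus.MStar (TuranTorus.toTorus '' ((N : ℝ)⁻¹ • Ω))
        (TuranTorus.toTorus ((N : ℝ)⁻¹ • z)) ≤
      TuranTorus.MStar (TuranTorus.toTorus '' Ω) (TuranTorus.toTorus z) := by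
  refine iSup₂_le fun f hf => ?_
  obtain ⟨g, hg, hval⟩ := TuranTorus.exists_mem_FStar_of_dilation hbox hN hf
  rw [← hval z hz]
  exact le_iSup₂ (f := fun g (_ : g ∈ TuranTorus.FStar _) =>
    ((g (TuranTorus.toTorus z) : ℝ) : EReal)) g hg
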